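/- Let $p\in[1,\infty)$ and let $\mathcal X,\mathcal Y$ be Polish spaces, each with a compatible metric $d$ and its Borel $\sigma$-field. Let $\mathcal P_p(\mathcal X)$ be the set of Borel probability measures $\mu$ on $\mathcal X$ with $\int d(x_0,x)^p\,\mu(dx)<\infty$ for some (equivalently every) $x_0\in\mathcal X$, and let $$W_p(\mu,\nu)=\Big(\inf_{\pi}\int d(x,y)^p\,\pi(dx,dy)\Big)^{1/p},$$ the infimum being over all couplings $\pi$ of $\mu$ and $\nu$. Let $\mathcal Q_p(\mathcal X,\mathcal Y)$ be the set of Markov kernels $Q$ from $\mathcal X$ to $\mathcal Y$ for which there are $x_0$, $y_0$ and $C>0$ with $\int d(y,y_0)^p\,Q(dy|x)\le C(1+d(x,x_0)^p)$ for all $x\in\mathcal X$. For $\lambda\in\mathcal P_p(\mathcal X)$ and $P,Q\in\mathcal Q_p(\mathcal X,\mathcal Y)$ the integrated transportation distance is $$\mathcal W_p^\lambda(P,Q)=\Big(\int_{\mathcal X}W_p\big(P(\cdot|x),Q(\cdot|x)\big)^p\,\lambda(dx)\Big)^{1/p}.$$ A kernel $Q$ is Lipschitz with constant $L$ if $W_p(Q(\cdot|x),Q(\cdot|x'))\le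 L\,d(x,x')$ for all $x,x'\in\mathcal X$. Let $\lambda\in\mathcal P_p(\mathcal X)$ and $(\lambda_k)\subset\mathcal P_p(\mathcal X)$. Let $P,Q\in\mathcal Q_p(\mathcal X,\mathcal Y)$ be Lipschitz kernels, and let $(P_m),(Q_n)\subset\mathcal Q_p(\mathcal X,\mathcal Y)$ be Lipschitz sequences of kernels, that is, there is a constant $L$ such that all $P_m$ and all $Q_n$ are Lipschitz with constant $L$. Suppose that 1. $\lambda_k\to\lambda$ weakly in $\mathcal P_p(\mathcal X)$: $\int\varphi\,d\lambda_k\to\int\varphi\,d\lambda$ for every bounded continuous $\varphi$, and $\int d(x_0,x)^p\,\lambda_k(dx)\to\int d(x_0,x)^p\,\lambda(dx)$ for some $x_0\in\mathcal X$; 2. $P_m\to P$ and $Q_n\to Q$ weakly in the kernel space with respect to the marginal $\lambda$: for some $y_0\in\mathcal Y$ and every continuous $f:\mathcal X\times\mathcal Y\to\mathbb R$ with $|f(x,y)|\le 1+d(y_0,y)^p$, $$\int\!\!\int f(x,y)\,P_m(dy|x)\,\lambda(dx)\to\int\!\!\int f(x,y)\,P(dy|x)\,\lambda(dx),$$ and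 likewise for $Q_n$ and $Q$, with some $y_0$. Then all the distances $\mathcal W_p^{\lambda_k}(P_m,Q_n)$ and $\mathcal W_p^{\lambda}(P,Q)$ are finite, and, jointly in $(k,m,n)$, $$\lim_{k,m,n\to\infty}\mathcal W_p^{\lambda_k}(P_m,Q_n)=\mathcal W_p^\lambda(P,Q).$$ -/

import Mathlib

open MeasureTheory ProbabilityTheory Filter Topology
open scoped ENNReal NNReal

namespace ITD

/-- The couplings of `μ` and `ν`: the measures on the product with marginals `μ` and `ν`
(if `μ` and `ν` are probability measures, such a measure is a probability measure too). -/
def couplings {X : Type*} [MeasurableSpace X] (μ ν : Measure X) : Set (Measure (X × X)) :=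
  {π | π.fst = μ ∧ π.snd = ν}

/-- The optimal transport (Wasserstein) distance of order `p`, with values in `[0, ∞]`. -/
noncomputable def wasserstein {X : Type*} [MetricSpace X] [MeasurableSpace X]
    (p : ℝ) (μ ν : Measure X) : ℝ≥0∞ :=
  (⨅ π ∈ couplings μ ν, ∫⁻ z, edist z.1 z.2 ^ p ∂π) ^ (1 / p)

/-- The space of probability measures with finite moment of order `p`. -/
def measureSpace (X : Type*) [MetricSpace X] [MeasurableSpace X] (p : ℝ) :
    Set (ProbabilityMeasure X) :=
  {μ | ∃ x₀ : X, ∫⁻ x, edist x₀ x ^ p ∂(μ : Measure X) < ∞}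

/-- Weak convergence in the space of probability measures with finite moment of order `p`:
narrow convergence together with convergence of the moments of order `p`. -/
def WeakConvMeasure {X : Type*} [MetricSpace X] [MeasurableSpace X] [BorelSpace X] (p : ℝ)
    (μs : ℕ → ProbabilityMeasure X) (μ : ProbabilityMeasure X) : Prop :=
  Tendsto μs atTop (𝓝 μ) ∧
    ∃ x₀ : X, Tendsto (fun k => ∫⁻ x, edist x₀ x ^ p ∂(μs k : Measure X)) atTop
      (𝓝 (∫⁻ x, edist x₀ x ^ p ∂(μ : Measure X)))

/-- The kernel space of order `p`: Markov kernels whose moments of order `p` grow at most like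
`1 + d(x, x₀) ^ p`. In particular each `Q x` has a finite moment of order `p`. -/
def kernelSpace (X Y : Type*) [MetricSpace X] [MeasurableSpace X] [MetricSpace Y]
    [MeasurableSpace Y] (p : ℝ) : Set (Kernel X Y) :=
  {Q | IsMarkovKernel Q ∧ ∃ (x₀ : X) (y₀ : Y) (C : ℝ≥0), ∀ x : X,
    ∫⁻ y, edist y y₀ ^ p ∂(Q x) ≤ C * (1 + edist x x₀ ^ p)}

/-- `Q` is Lipschitz with constant `L`, as a map into measures with the distance of order `p`. -/
def LipschitzKernelWith {X Y : Type*} [MetricSpace X] [MeasurableSpace X] [MetricSpace Y]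
    [MeasurableSpace Y] (p : ℝ) (L : ℝ≥0) (Q : Kernel X Y) : Prop :=
  ∀ x x' : X, wasserstein p (Q x) (Q x') ≤ L * edist x x'

/-- The integrated transportation distance of order `p` with marginal `lam`. -/
noncomputable def itd {X Y : Type*} [MetricSpace X] [MeasurableSpace X] [MetricSpace Y]
    [MeasurableSpace Y] (p : ℝ) (lam : ProbabilityMeasure X) (P Q : Kernel X Y) : ℝ≥0∞ :=
  (∫⁻ x, wasserstein p (P x) (Q x) ^ p ∂(lam : Measure X)) ^ (1 / p)

/-- Weak convergence of kernels with respect to the marginal `lam`: convergence of the iterated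
integrals of every continuous `f` with `|f (x, y)| ≤ 1 + d(y₀, y) ^ p`. For kernels in the kernel
space and `lam` with finite moment of order `p`, all these integrals converge absolutely. -/
def WeakConvKernel {X Y : Type*} [MetricSpace X] [MeasurableSpace X] [MetricSpace Y]
    [MeasurableSpace Y] (p : ℝ) (lam : ProbabilityMeasure X)
    (Qs : ℕ → Kernel X Y) (Q : Kernel X Y) : Prop :=
  ∃ y₀ : Y, ∀ f : X × Y → ℝ, Continuous f → (∀ x y, |f (x, y)| ≤ 1 + dist y₀ y ^ p) →
    Tendsto (fun n => ∫ x, ∫ y, f (x, y) ∂(Qs n x) ∂(lam : Measure X)) atTop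
      (𝓝 (∫ x, ∫ y, f (x, y) ∂(Q x) ∂(lam : Measure X)))

end ITD

/-! By the triangle inequality, the difference between the distance of `P_m` and `Q_n` under `λ_k`
and that of `P` and `Q` under `λ` is at most the sum of the `λ`-distances from `P_m` to `P` and from
`Q_n` to `Q`, plus `2L * W_p(λ_k, λ)`. The last term appears because `x ↦ W_p(P_m x, Q_n x)` is
`2L`-Lipschitz, and Minkowski's inequality on a coupling of two marginals shows that `L^p` norms of
Lipschitz functions move by at most the constant times `W_p` (`lintegral_rpow_le_add_wasserstein`).
Each term tends to zero separately, which gives the joint limit.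

That `W_p(λ_k, λ) → 0` is `tendsto_wasserstein_of_tendsto`: most mass is transported inside small
continuity sets, and the rest is controlled by the tails of the moments.

For the kernels (`tendsto_itd_zero`), weak convergence controls only averages over `x`. For
Lipschitz `u` and `1 ≤ q ≤ p`, the functions `x ↦ (∫ u ^ q dQ_n(x)) ^ (1 / q)` are uniformly
Lipschitz, so testing against bump functions in `x` gives their convergence at each point of the
support of `λ`. Taking `q = p` and `u = d(y₀, ·)` gives the moments, and `q = 1` with bounded `u`
gives narrow convergence. Hence `W_p(Q_n x, Q x) → 0` on the support, and dominated convergence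
concludes. -/

namespace ITD

/-! ### Couplings and their marginals. -/

section Couplings

variable {X : Type*} [MeasurableSpace X] {μ ν : Measure X}

theorem swap_mem_couplings {π : Measure (X × X)} (hπ : π ∈ couplings μ ν) :
    π.map Prod.swap ∈ couplings ν μ := by
  refine ⟨?_, ?_⟩
  · rw [Measure.fst, Measure.map_map measurable_fst measurable_swap]; exact hπ.2
  · rw [Measure.snd, Measure.map_map measurable_snd measurable_swap]; exact hπ.1

theorem lintegral_fst_coupling {π : Measure (X × X)} (hπ : π ∈ couplings μ ν)
    {f : X → ℝ≥0∞} (hf : Measurable f) : ∫⁻ z, f z.1 ∂π = ∫⁻ x, f x ∂μ := by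
  rw [← hπ.1, Measure.fst, lintegral_map hf measurable_fst]

theorem lintegral_snd_coupling {π : Measure (X × X)} (hπ : π ∈ couplings μ ν)
    {f : X → ℝ≥0∞} (hf : Measurable f) : ∫⁻ z, f z.2 ∂π = ∫⁻ x, f x ∂ν := by
  rw [← hπ.2, Measure.snd, lintegral_map hf measurable_snd]

theorem isProbabilityMeasure_of_mem_couplings [IsProbabilityMeasure μ] {π : Measure (X × X)}
    (hπ : π ∈ couplings μ ν) : IsProbabilityMeasure π := by
  constructor
  rw [← Measure.fst_univ, hπ.1, measure_univ]

theorem prod_mem_couplings (μ ν : Measure X) [IsProbabilityMeasure μ] [IsProbabilityMeasure ν] :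
    μ.prod ν ∈ couplings μ ν :=
  ⟨Measure.fst_prod, Measure.snd_prod⟩

end Couplings

theorem lintegral_rpow_mono_exponent {p q : ℝ} {Ω : Type*} [MeasurableSpace Ω] (P : Measure Ω)
    [IsProbabilityMeasure P] {f : Ω → ℝ≥0∞} (hf : Measurable f) (hq : 0 < q) (hqp : q ≤ p) :
    (∫⁻ x, f x ^ q ∂P) ^ (1 / q) ≤ (∫⁻ x, f x ^ p ∂P) ^ (1 / p) := by
  have := eLpNorm'_le_eLpNorm'_of_exponent_le (f := f) hq hqp P hf.aestronglyMeasurable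
  simpa [eLpNorm'] using this

/-! ### Elementary properties of the Wasserstein distance. -/

section Wasserstein

variable {X : Type*} [MetricSpace X] [MeasurableSpace X] {p q : ℝ} {μ ν : Measure X}

theorem wasserstein_eq_iInf (hp : 0 < p) (μ ν : Measure X) :
    wasserstein p μ ν =
      ⨅ π : couplings μ ν, (∫⁻ z, edist z.1 z.2 ^ p ∂(π : Measure (X × X))) ^ (1 / p) := by
  have h : ∀ x : ℝ≥0∞, x ^ (1 / p) = ENNReal.orderIsoRpow (1 / p) (by positivity) x :=
    fun _ => rfl
  simp only [wasserstein, h, OrderIso.map_iInf, iInf_subtype]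

theorem wasserstein_le (hp : 0 < p) {π : Measure (X × X)} (hπ : π ∈ couplings μ ν) :
    wasserstein p μ ν ≤ (∫⁻ z, edist z.1 z.2 ^ p ∂π) ^ (1 / p) := by
  rw [wasserstein_eq_iInf hp]
  exact iInf_le_of_le ⟨π, hπ⟩ le_rfl

theorem wasserstein_le_swap (hp : 0 < p) (μ ν : Measure X) :
    wasserstein p μ ν ≤ wasserstein p ν μ := by
  rw [wasserstein_eq_iInf hp ν μ]
  refine le_iInf fun π => (wasserstein_le hp (swap_mem_couplings π.2)).trans (le_of_eq ?_)
  have : Measure.map Prod.swap (π : Measure (X × X)) =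
    Measure.map MeasurableEquiv.prodComm (π : Measure (X × X)) := rfl
  rw [this, lintegral_map_equiv]
  refine congrArg (· ^ (1 / p)) (lintegral_congr fun z => ?_)
  rw [edist_comm]
  rfl

theorem wasserstein_comm (hp : 0 < p) (μ ν : Measure X) :
    wasserstein p μ ν = wasserstein p ν μ :=
  le_antisymm (wasserstein_le_swap hp μ ν) (wasserstein_le_swap hp ν μ)

variable [SecondCountableTopology X] [BorelSpace X]

theorem measurable_edist_rpow : Measurable fun z : X × X => edist z.1 z.2 ^ p :=
  (measurable_fst.edist measurable_snd).pow_const p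

/-- Minkowski's inequality on an arbitrary coupling, followed by the infimum over couplings. It
serves twice: in `Y` to make moments of kernels Lipschitz in `x`, and in `X` to change the marginal.
-/
theorem lintegral_rpow_le_add_wasserstein [IsProbabilityMeasure μ] [IsProbabilityMeasure ν]
    (hq : 1 ≤ q) (hqp : q ≤ p)
    {h : X → ℝ≥0∞} (hm : Measurable h) {C : ℝ≥0∞} (hC : C ≠ ∞)
    (hh : ∀ x x', h x ≤ h x' + C * edist x x') :
    (∫⁻ x, h x ^ q ∂μ) ^ (1 / q) ≤ (∫⁻ x, h x ^ q ∂ν) ^ (1 / q) + C * wasserstein p μ ν := by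
  have hq0 : 0 < q := by linarith
  -- The product coupling makes the index set nonempty, which is needed to move the factor inside
  -- the infimum when `C = 0`.
  rw [wasserstein_eq_iInf (hq0.trans_le hqp), ENNReal.mul_iInf' (fun h => absurd h hC)
    (fun _ => ⟨⟨_, prod_mem_couplings μ ν⟩⟩), ENNReal.add_iInf]
  refine le_iInf fun ⟨π, hπ⟩ => ?_
  have := isProbabilityMeasure_of_mem_couplings hπ
  rw [← lintegral_fst_coupling hπ (hm.pow_const q), ← lintegral_snd_coupling hπ (hm.pow_const q)]
  have hme : Measurable fun z : X × X => edist z.1 z.2 := measurable_fst.edist measurable_snd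
  calc (∫⁻ z, h z.1 ^ q ∂π) ^ (1 / q)
      ≤ (∫⁻ z, (h z.2 + C * edist z.1 z.2) ^ q ∂π) ^ (1 / q) := by
        gcongr with z; exact hh _ _
    _ ≤ (∫⁻ z, h z.2 ^ q ∂π) ^ (1 / q) + (∫⁻ z, (C * edist z.1 z.2) ^ q ∂π) ^ (1 / q) :=
        ENNReal.lintegral_Lp_add_le (hm.comp measurable_snd).aemeasurable
          (hme.const_mul C).aemeasurable hq
    _ ≤ _ := by
        gcongr
        simp_rw [ENNReal.mul_rpow_of_nonneg _ _ hq0.le]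
        rw [lintegral_const_mul _ (hme.pow_const q), ENNReal.mul_rpow_of_nonneg _ _ (by positivity),
          ← ENNReal.rpow_mul, mul_one_div_cancel hq0.ne', ENNReal.rpow_one]
        gcongr
        exact lintegral_rpow_mono_exponent π hme hq0 hqp

end Wasserstein

/-! ### Gluing and the triangle inequality. -/

section Triangle

variable {X : Type*} [MetricSpace X] [PolishSpace X] [MeasurableSpace X] [BorelSpace X]
  {p : ℝ} {μ ν ρ : Measure X}

/-- Two couplings with a common marginal can be glued along it. -/
theorem exists_gluing [IsProbabilityMeasure μ] {π₁ π₂ : Measure (X × X)}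
    [IsProbabilityMeasure ν] (h₁ : π₁ ∈ couplings μ ν) (h₂ : π₂ ∈ couplings ν ρ) :
    ∃ γ : Measure (X × X × X), γ.map (fun w => (w.2.1, w.1)) = π₁ ∧
      γ.map (fun w => (w.1, w.2.2)) = π₂ := by
  have : Nonempty X := nonempty_of_isProbabilityMeasure μ
  have i₁ := isProbabilityMeasure_of_mem_couplings h₁
  have i₂ := isProbabilityMeasure_of_mem_couplings h₂
  have i₃ : IsProbabilityMeasure (π₁.map Prod.swap) :=
    Measure.isProbabilityMeasure_map measurable_swap.aemeasurable
  set κ := (π₁.map Prod.swap).condKernel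
  set η := π₂.condKernel
  have e₁ : ν ⊗ₘ κ = π₁.map Prod.swap := by
    rw [← (swap_mem_couplings h₁).1]; exact Measure.disintegrate _ _
  have e₂ : ν ⊗ₘ η = π₂ := by
    conv_rhs => rw [← Measure.disintegrate π₂ η]
    rw [h₂.1]
  -- Given the shared point, which is the first coordinate, the two outer points are drawn
  -- independently from the two conditional laws.
  refine ⟨ν ⊗ₘ (κ ×ₖ η), ?_, ?_⟩
  · have : (ν ⊗ₘ (κ ×ₖ η)).map (Prod.map id Prod.fst) = ν ⊗ₘ κ := by
      rw [← Measure.compProd_map measurable_fst]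
      congr 1
      exact (Kernel.fst_eq _).symm.trans (Kernel.fst_prod κ η)
    have h : (fun w : X × X × X => (w.2.1, w.1)) = Prod.swap ∘ Prod.map id Prod.fst := rfl
    rw [h, ← Measure.map_map measurable_swap (by fun_prop), this, e₁,
      Measure.map_map measurable_swap measurable_swap]
    simp
  · have : (ν ⊗ₘ (κ ×ₖ η)).map (Prod.map id Prod.snd) = ν ⊗ₘ η := by
      rw [← Measure.compProd_map measurable_snd]
      congr 1
      exact (Kernel.snd_eq _).symm.trans (Kernel.snd_prod κ η)
    rw [← e₂, ← this]
    rfl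

/-- The triangle inequality for the Wasserstein distance. -/
theorem wasserstein_triangle (hp : 1 ≤ p) (μ ν ρ : Measure X)
    [IsProbabilityMeasure μ] [IsProbabilityMeasure ν] :
    wasserstein p μ ρ ≤ wasserstein p μ ν + wasserstein p ν ρ := by
  have hp0 : 0 < p := by linarith
  rw [wasserstein_eq_iInf hp0 μ ν, wasserstein_eq_iInf hp0 ν ρ, ENNReal.iInf_add]
  refine le_iInf fun ⟨π₁, h₁⟩ => ?_
  rw [ENNReal.add_iInf]
  refine le_iInf fun ⟨π₂, h₂⟩ => ?_
  obtain ⟨γ, g₁, g₂⟩ := exists_gluing h₁ h₂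
  have m₁ : Measurable fun w : X × X × X => (w.2.1, w.1) := by fun_prop
  have m₂ : Measurable fun w : X × X × X => (w.1, w.2.2) := by fun_prop
  have m₃ : Measurable fun w : X × X × X => w.2 := by fun_prop
  have hγ : γ.map (fun w => w.2) ∈ couplings μ ρ := by
    constructor
    · rw [← h₁.1, ← g₁, Measure.fst, Measure.fst, Measure.map_map measurable_fst m₃,
        Measure.map_map measurable_fst m₁]
      rfl
    · rw [← h₂.2, ← g₂, Measure.snd, Measure.snd, Measure.map_map measurable_snd m₃,
        Measure.map_map measurable_snd m₂]
      rfl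
  refine (wasserstein_le hp0 hγ).trans ?_
  dsimp only
  rw [← g₁, ← g₂, lintegral_map measurable_edist_rpow m₁, lintegral_map measurable_edist_rpow m₂,
    lintegral_map measurable_edist_rpow m₃]
  have a₁ : Measurable fun w : X × X × X => edist w.2.1 w.1 := by fun_prop
  have a₂ : Measurable fun w : X × X × X => edist w.1 w.2.2 := by fun_prop
  refine le_trans ?_ (ENNReal.lintegral_Lp_add_le a₁.aemeasurable a₂.aemeasurable hp)
  gcongr with w
  exact edist_triangle _ _ _

end Triangle

/-! ### Mass left over by a partial coupling. -/

section Remainders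

variable {X : Type*} [MeasurableSpace X]

/-- The product divided by the common mass works. If that mass is zero, the scalar is infinite but
both measures vanish. -/
theorem exists_remainder_coupling {α β : Measure X} [IsFiniteMeasure α] [IsFiniteMeasure β]
    (h : α Set.univ = β Set.univ) : ∃ θ : Measure (X × X), θ ∈ couplings α β := by
  refine ⟨(α Set.univ)⁻¹ • α.prod β, ?_, ?_⟩
  · rw [Measure.fst, Measure.map_smul, Measure.map_fst_prod, ← h, smul_smul]
    by_cases h0 : α Set.univ = 0
    · rw [Measure.measure_univ_eq_zero.1 h0, smul_zero]
    · rw [ENNReal.inv_mul_cancel h0 (measure_ne_top _ _), one_smul]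
  · rw [Measure.snd, Measure.map_smul, Measure.map_snd_prod, h, smul_smul]
    by_cases h0 : β Set.univ = 0
    · rw [Measure.measure_univ_eq_zero.1 h0, smul_zero]
    · rw [ENNReal.inv_mul_cancel h0 (measure_ne_top _ _), one_smul]

/-- Cut `f` at height `R`: the excess is integrated against all of `μ`, and the capped part costs at
most `R` per unit of mass of `α`. So a submeasure of small mass has a small moment once the tail of
`μ` is small. -/
theorem lintegral_le_tail_add {μ α : Measure X} (h : α ≤ μ) (f : X → ℝ≥0∞) (R : ℝ≥0∞) :
    ∫⁻ x, f x ∂α ≤ ∫⁻ x, (f x - R) ∂μ + R * α Set.univ := by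
  calc ∫⁻ x, f x ∂α ≤ ∫⁻ x, ((f x - R) + R) ∂α := lintegral_mono fun x => le_tsub_add
    _ = ∫⁻ x, (f x - R) ∂α + R * α Set.univ := by
      rw [lintegral_add_right _ measurable_const, lintegral_const]
    _ ≤ _ := by gcongr

theorem inv_max_mul_le_one_right (a b : ℝ≥0∞) : (max a b)⁻¹ * b ≤ 1 :=
  (mul_le_mul_right (le_max_right a b) _).trans (ENNReal.inv_mul_le_one _)

theorem inv_max_mul_le_one_left (a b : ℝ≥0∞) : (max a b)⁻¹ * a ≤ 1 :=
  (mul_le_mul_right (le_max_left a b) _).trans (ENNReal.inv_mul_le_one _)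

theorem inv_max_mul_mul {a b : ℝ≥0∞} (ha : a ≠ ∞) (hb : b ≠ ∞) :
    (max a b)⁻¹ * (a * b) = min a b := by
  rcases eq_or_ne (max a b) 0 with h | h
  · have : a = 0 := le_antisymm ((le_max_left a b).trans h.le) bot_le
    simp [this]
  · rw [← max_mul_min a b, ← mul_assoc, ENNReal.inv_mul_cancel h (max_lt ha.lt_top hb.lt_top).ne,
      one_mul]

theorem sum_measure_inter_le (μ : Measure X) {A : ℕ → Set X} (hA : ∀ n, MeasurableSet (A n))
    (hd : Pairwise (Function.onFun Disjoint A)) (N : ℕ) {s : Set X} (hs : MeasurableSet s) :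
    ∑ i ∈ Finset.range N, μ (s ∩ A i) ≤ μ s := by
  rw [← measure_biUnion_finset (fun i _ j _ hij => ((hd hij).mono Set.inter_subset_right
    Set.inter_subset_right)) (fun i _ => hs.inter (hA i))]
  exact measure_mono (Set.iUnion₂_subset fun i _ => Set.inter_subset_left)

end Remainders

theorem lintegral_coupling_le {X : Type*} [MetricSpace X] [MeasurableSpace X]
    [BorelSpace X] {p : ℝ} (hp : 1 ≤ p) {α β : Measure X} {θ : Measure (X × X)}
    (hθ : θ ∈ couplings α β) (x₀ : X) :
    ∫⁻ z, edist z.1 z.2 ^ p ∂θ ≤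
      2 ^ (p - 1) * (∫⁻ x, edist x₀ x ^ p ∂α + ∫⁻ x, edist x₀ x ^ p ∂β) := by
  have hm : Measurable fun x : X => edist x₀ x ^ p := by fun_prop
  rw [← lintegral_fst_coupling hθ hm, ← lintegral_snd_coupling hθ hm,
    ← lintegral_add_left (f := fun z : X × X => edist x₀ z.1 ^ p) (hm.comp measurable_fst),
    ← lintegral_const_mul _ (by fun_prop)]
  refine lintegral_mono fun z => ?_
  refine le_trans ?_ (ENNReal.rpow_add_le_mul_rpow_add_rpow _ _ hp)
  gcongr
  exact edist_triangle_left _ _ _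

/-! ### Partitions and partial couplings. -/

section PartialCouplings

variable {X : Type*} [MetricSpace X] [SecondCountableTopology X] [MeasurableSpace X] [BorelSpace X]
  {p : ℝ}

/-- A partition into countably many continuity sets of small diameter. -/
theorem exists_partition_null_frontier (μ : Measure X) [IsFiniteMeasure μ] {ε : ℝ} (hε : 0 < ε) :
    ∃ A : ℕ → Set X, (∀ n, MeasurableSet (A n)) ∧ (∀ n, μ (frontier (A n)) = 0) ∧
      (∀ n, ∀ x ∈ A n, ∀ y ∈ A n, edist x y ≤ ENNReal.ofReal ε) ∧ ⋃ n, A n = Set.univ ∧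
      Pairwise (Function.onFun Disjoint A) := by
  cases isEmpty_or_nonempty X
  · exact ⟨fun _ => ∅, by simp, by simp, by simp, Subsingleton.elim _ _, fun _ _ _ => by simp⟩
  obtain ⟨c, hc⟩ := TopologicalSpace.exists_dense_seq X
  -- Radii above `ε / 4` let the balls around a dense sequence cover the space, radii below `ε / 2`
  -- keep the diameters below `ε`, and some radius in between has a null frontier.
  have h := fun n => exists_null_frontier_thickening μ {c n} (show ε / 4 < ε / 2 by linarith)
  choose r hr hr0 using h
  set B : ℕ → Set X := fun n => Metric.thickening (r n) {c n}
  refine ⟨disjointed B, fun n => MeasurableSet.disjointed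
    (fun n => Metric.isOpen_thickening.measurableSet) n, fun n => ?_, fun n x hx y hy => ?_, ?_,
    disjoint_disjointed B⟩
  · refine disjointedRec (p := fun s => μ (frontier s) = 0) (fun t i ht => ?_) (hr0 n)
    refine measure_mono_null (t := frontier t ∪ frontier (B i)) ?_ (measure_union_null ht (hr0 i))
    rw [Set.sdiff_eq]
    refine (frontier_inter_subset _ _).trans ?_
    rw [frontier_compl]
    exact Set.union_subset_union Set.inter_subset_left Set.inter_subset_right
  · have hx' := disjointed_subset B n hx
    have hy' := disjointed_subset B n hy
    simp only [B, Metric.thickening_singleton, Metric.mem_ball] at hx' hy'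
    rw [edist_dist]
    refine ENNReal.ofReal_le_ofReal ((dist_triangle_right x y (c n)).trans ?_)
    linarith [(hr n).2]
  · rw [iUnion_disjointed, Set.eq_univ_iff_forall]
    intro x
    obtain ⟨n, hn⟩ := Metric.denseRange_iff.1 hc x (ε / 4) (by linarith)
    refine Set.mem_iUnion.2 ⟨n, ?_⟩
    simp only [B, Metric.thickening_singleton, Metric.mem_ball]
    linarith [(hr n).1]

/-- A partial coupling bounds the Wasserstein distance, up to the tails of the moments and the mass
that is not transported. -/
theorem wasserstein_rpow_le_of_partial_coupling (hp : 1 ≤ p) {μ ν : Measure X}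
    [IsProbabilityMeasure μ] [IsProbabilityMeasure ν] {η : Measure (X × X)} (h₁ : η.fst ≤ μ)
    (h₂ : η.snd ≤ ν) (x₀ : X) (R : ℝ≥0∞) :
    wasserstein p μ ν ^ p ≤ ∫⁻ z, edist z.1 z.2 ^ p ∂η +
      2 ^ (p - 1) * ((∫⁻ x, (edist x₀ x ^ p - R) ∂μ + R * (1 - η Set.univ)) +
        (∫⁻ x, (edist x₀ x ^ p - R) ∂ν + R * (1 - η Set.univ))) := by
  have hp0 : 0 < p := by linarith
  have : IsFiniteMeasure η.fst := isFiniteMeasure_of_le μ h₁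
  have : IsFiniteMeasure η.snd := isFiniteMeasure_of_le ν h₂
  have u₁ : (μ - η.fst) Set.univ = 1 - η Set.univ := by
    rw [Measure.sub_apply MeasurableSet.univ h₁, measure_univ, Measure.fst_univ]
  have u₂ : (ν - η.snd) Set.univ = 1 - η Set.univ := by
    rw [Measure.sub_apply MeasurableSet.univ h₂, measure_univ, Measure.snd_univ]
  have : IsFiniteMeasure (μ - η.fst) := isFiniteMeasure_of_le μ Measure.sub_le
  have : IsFiniteMeasure (ν - η.snd) := isFiniteMeasure_of_le ν Measure.sub_le
  obtain ⟨θ, hθ⟩ := exists_remainder_coupling (u₁.trans u₂.symm)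
  have hπ : η + θ ∈ couplings μ ν := by
    constructor
    · rw [Measure.fst, Measure.map_add _ _ measurable_fst, ← Measure.fst, ← Measure.fst, hθ.1,
        add_comm, Measure.sub_add_cancel_of_le h₁]
    · rw [Measure.snd, Measure.map_add _ _ measurable_snd, ← Measure.snd, ← Measure.snd, hθ.2,
        add_comm, Measure.sub_add_cancel_of_le h₂]
  have := ENNReal.rpow_le_rpow (wasserstein_le hp0 hπ) hp0.le
  rw [← ENNReal.rpow_mul, one_div_mul_cancel hp0.ne', ENNReal.rpow_one,
    lintegral_add_measure] at this
  refine this.trans ?_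
  gcongr
  refine (lintegral_coupling_le hp hθ x₀).trans ?_
  -- The same number is written as the mass of `μ - η.fst` in the first summand and of `ν - η.snd`
  -- in the second, so that each remainder meets its own tail bound.
  rw [← u₁]
  nth_rw 2 [u₁]
  rw [← u₂]
  gcongr
  · exact lintegral_le_tail_add Measure.sub_le _ _
  · exact lintegral_le_tail_add Measure.sub_le _ _

end PartialCouplings

/-- On each cell take the product of the restrictions divided by the larger of the two masses. The
marginals then have densities at most one, the cell carries the smaller of the two masses, and no
pair leaves its cell, so each distance is at most `ε`. -/
theorem exists_partial_coupling {X : Type*} [MetricSpace X] [MeasurableSpace X] {p : ℝ}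
    (hp : 0 < p) (μ ν : Measure X) [IsProbabilityMeasure μ]
    [IsProbabilityMeasure ν] {A : ℕ → Set X} (hA : ∀ n, MeasurableSet (A n))
    (hd : Pairwise (Function.onFun Disjoint A)) {ε : ℝ≥0∞}
    (hε : ∀ n, ∀ x ∈ A n, ∀ y ∈ A n, edist x y ≤ ε) (N : ℕ) :
    ∃ η : Measure (X × X), η.fst ≤ μ ∧ η.snd ≤ ν ∧
      η Set.univ = ∑ i ∈ Finset.range N, min (μ (A i)) (ν (A i)) ∧
      ∫⁻ z, edist z.1 z.2 ^ p ∂η ≤ ε ^ p := by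
  set η : Measure (X × X) := ∑ i ∈ Finset.range N,
    (max (μ (A i)) (ν (A i)))⁻¹ • (μ.restrict (A i)).prod (ν.restrict (A i)) with hη
  have happ : ∀ s t, MeasurableSet s → MeasurableSet t → η (s ×ˢ t) = ∑ i ∈ Finset.range N,
      (max (μ (A i)) (ν (A i)))⁻¹ * (μ (s ∩ A i) * ν (t ∩ A i)) := fun s t hs ht => by
    simp [hη, Measure.restrict_apply, hs, ht]
  have huniv : η Set.univ = ∑ i ∈ Finset.range N, min (μ (A i)) (ν (A i)) := by
    rw [← Set.univ_prod_univ, happ _ _ .univ .univ]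
    refine Finset.sum_congr rfl fun i _ => ?_
    rw [Set.univ_inter, inv_max_mul_mul (measure_ne_top _ _) (measure_ne_top _ _)]
  have h₁ : η.fst ≤ μ := by
    refine Measure.le_iff.2 fun s hs => ?_
    rw [Measure.fst_apply hs, ← Set.prod_univ, happ s _ hs .univ]
    refine le_trans (Finset.sum_le_sum fun i _ => ?_) (sum_measure_inter_le μ hA hd N hs)
    rw [Set.univ_inter, mul_left_comm]
    exact mul_le_of_le_one_right' (inv_max_mul_le_one_right _ _)
  have h₂ : η.snd ≤ ν := by
    refine Measure.le_iff.2 fun s hs => ?_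
    rw [Measure.snd_apply hs, ← Set.univ_prod, happ _ s .univ hs]
    refine le_trans (Finset.sum_le_sum fun i _ => ?_) (sum_measure_inter_le ν hA hd N hs)
    rw [Set.univ_inter, ← mul_assoc]
    exact mul_le_of_le_one_left' (inv_max_mul_le_one_left _ _)
  refine ⟨η, h₁, h₂, huniv, ?_⟩
  have hae : ∀ᵐ z ∂η, edist z.1 z.2 ^ p ≤ ε ^ p := by
    rw [hη, ae_finsetSum_measure_iff]
    intro i _
    refine Measure.ae_smul_measure ?_ _
    rw [Measure.prod_restrict]
    filter_upwards [ae_restrict_mem ((hA i).prod (hA i))] with z hz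
    exact ENNReal.rpow_le_rpow (hε i _ hz.1 _ hz.2) hp.le
  calc ∫⁻ z, edist z.1 z.2 ^ p ∂η ≤ ∫⁻ _, ε ^ p ∂η := lintegral_mono_ae hae
    _ = ε ^ p * η.fst Set.univ := by rw [lintegral_const, Measure.fst_univ]
    _ ≤ ε ^ p * μ Set.univ := by gcongr
    _ = ε ^ p := by rw [measure_univ, mul_one]

/-! ### From narrow convergence and moments to Wasserstein convergence. -/

section WeakConvergence

variable {X ι : Type*} [MetricSpace X] [MeasurableSpace X] [BorelSpace X] {p : ℝ}
  {l : Filter ι} {μs : ι → ProbabilityMeasure X} {μ : ProbabilityMeasure X}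

/-- The tail is `f - min f R`, where the integrals of `f` converge by assumption and those of `min f
R` because it is bounded and continuous. -/
theorem tendsto_lintegral_tail (h : Tendsto μs l (𝓝 μ)) {f : X → ℝ≥0} (hf : Continuous f)
    (hlim : Tendsto (fun i => ∫⁻ x, f x ∂(μs i : Measure X)) l (𝓝 (∫⁻ x, f x ∂(μ : Measure X))))
    (hfin : ∫⁻ x, f x ∂(μ : Measure X) ≠ ∞) (R : ℝ≥0) :
    Tendsto (fun i => ∫⁻ x, ((f x : ℝ≥0∞) - R) ∂(μs i : Measure X)) l
      (𝓝 (∫⁻ x, ((f x : ℝ≥0∞) - R) ∂(μ : Measure X))) := by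
  have hmin : Tendsto (fun i => ∫⁻ x, min (f x : ℝ≥0∞) R ∂(μs i : Measure X)) l
      (𝓝 (∫⁻ x, min (f x : ℝ≥0∞) R ∂(μ : Measure X))) := by
    have hb : ∀ x y, dist (min (f x) R) (min (f y) R) ≤ R := fun x y => by
      rw [NNReal.dist_eq, abs_le]
      have hx : ((min (f x) R : ℝ≥0) : ℝ) ≤ R := NNReal.coe_le_coe.2 (min_le_right _ _)
      have hy : ((min (f y) R : ℝ≥0) : ℝ) ≤ R := NNReal.coe_le_coe.2 (min_le_right _ _)
      have hx0 := (min (f x) R).coe_nonneg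
      have hy0 := (min (f y) R).coe_nonneg
      constructor <;> linarith
    have := ProbabilityMeasure.tendsto_iff_forall_lintegral_tendsto.1 h
      (BoundedContinuousFunction.mkOfBound ⟨fun x => min (f x) R, by fun_prop⟩ R hb)
    simpa using this
  have hsub : ∀ ρ : ProbabilityMeasure X, ∫⁻ x, ((f x : ℝ≥0∞) - R) ∂(ρ : Measure X) =
      ∫⁻ x, f x ∂(ρ : Measure X) - ∫⁻ x, min (f x : ℝ≥0∞) R ∂(ρ : Measure X) := fun ρ => by
    have hmeas : Measurable fun x => min (f x : ℝ≥0∞) R :=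
      (hf.measurable.coe_nnreal_ennreal).min measurable_const
    rw [← lintegral_sub hmeas]
    · refine lintegral_congr fun x => ?_
      rw [tsub_min]
    · refine ((lintegral_mono fun x => min_le_right _ _).trans_lt ?_).ne
      simp
    · exact ae_of_all _ fun x => min_le_left _ _
  simp_rw [hsub]
  exact ENNReal.Tendsto.sub hlim hmin (Or.inl hfin)

theorem tendsto_lintegral_tail_zero {μ : Measure X} {f : X → ℝ≥0} (hf : Continuous f)
    (hfin : ∫⁻ x, f x ∂μ ≠ ∞) :
    Tendsto (fun R : ℕ => ∫⁻ x, ((f x : ℝ≥0∞) - ((R : ℝ≥0) : ℝ≥0∞)) ∂μ) atTop (𝓝 0) := by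
  have h0 : (0 : ℝ≥0∞) = ∫⁻ _, 0 ∂μ := by simp
  rw [h0]
  refine tendsto_lintegral_of_dominated_convergence (fun x => (f x : ℝ≥0∞))
    (fun n => (hf.measurable.coe_nnreal_ennreal).sub_const _)
    (fun n => ae_of_all _ fun x => tsub_le_self) hfin (ae_of_all _ fun x => ?_)
  obtain ⟨N, hN⟩ := exists_nat_ge (f x)
  refine tendsto_const_nhds.congr' ?_
  filter_upwards [eventually_ge_atTop N] with n hn
  rw [tsub_eq_zero_of_le]
  exact ENNReal.coe_le_coe.2 (hN.trans (by exact_mod_cast hn))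

/-- Narrow convergence with convergence of the moments of order `p` implies convergence in the
Wasserstein distance. -/
theorem tendsto_wasserstein_of_tendsto [SecondCountableTopology X] (hp : 1 ≤ p)
    (h : Tendsto μs l (𝓝 μ)) (x₀ : X)
    (hlim : Tendsto (fun i => ∫⁻ x, edist x₀ x ^ p ∂(μs i : Measure X)) l
      (𝓝 (∫⁻ x, edist x₀ x ^ p ∂(μ : Measure X))))
    (hfin : ∫⁻ x, edist x₀ x ^ p ∂(μ : Measure X) ≠ ∞) :
    Tendsto (fun i => wasserstein p (μs i : Measure X) μ) l (𝓝 0) := by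
  have hp0 : 0 < p := by linarith
  have hW : Tendsto (fun i => wasserstein p (μs i : Measure X) μ ^ p) l (𝓝 0) := by
    set f : X → ℝ≥0 := fun x => nndist x₀ x ^ p with hf_def
    have hf : Continuous f := by
      have : Continuous fun x => nndist x₀ x := by fun_prop
      exact (NNReal.continuous_rpow_const hp0.le).comp this
    have hfe : ∀ x, edist x₀ x ^ p = (f x : ℝ≥0∞) := fun x => by
      rw [hf_def, edist_nndist, ENNReal.coe_rpow_of_nonneg _ hp0.le]
    simp_rw [hfe] at hlim hfin
    set K : ℝ≥0∞ := 2 ^ (p - 1)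
    have hK : K ≠ ∞ := ENNReal.rpow_ne_top_of_nonneg (by linarith) (by simp)
    refine ENNReal.tendsto_nhds_zero.2 fun ε hε => ?_
    -- The order of choices matters: the cell diameter `δ`, then the cutoff `R` making the tails
    -- small, then the number `N` of cells, because the mass missed by these cells is weighted by
    -- `R`.
    obtain ⟨δ, hδ, hδε⟩ : ∃ δ : ℝ, 0 < δ ∧ ENNReal.ofReal δ ^ p < ε := by
      have : Tendsto (fun δ : ℝ => ENNReal.ofReal δ ^ p) (𝓝[>] 0) (𝓝 0) := by
        have h := (ENNReal.continuous_rpow_const (y := p)).comp ENNReal.continuous_ofReal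
        have h' := h.tendsto 0
        simp only [Function.comp_def, ENNReal.ofReal_zero, ENNReal.zero_rpow_of_pos hp0] at h'
        exact h'.mono_left nhdsWithin_le_nhds
      obtain ⟨δ, h₁, h₂⟩ := ((this.eventually_lt_const hε).and self_mem_nhdsWithin).exists
      exact ⟨δ, h₂, h₁⟩
    set T : ℝ≥0 → Measure X → ℝ≥0∞ := fun R ρ => ∫⁻ x, ((f x : ℝ≥0∞) - R) ∂ρ
    obtain ⟨R, hR⟩ : ∃ R : ℝ≥0, ENNReal.ofReal δ ^ p + K * (T R μ + T R μ) < ε := by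
      have ht := tendsto_lintegral_tail_zero hf hfin
      have := (ENNReal.Tendsto.const_mul (ht.add ht) (Or.inr hK)).const_add (ENNReal.ofReal δ ^ p)
      simp only [add_zero, mul_zero] at this
      obtain ⟨R, hR⟩ := (this.eventually_lt_const hδε).exists
      exact ⟨R, hR⟩
    obtain ⟨A, hA, hA0, hAd, hAU, hAp⟩ := exists_partition_null_frontier (μ : Measure X) hδ
    obtain ⟨N, hN⟩ : ∃ N : ℕ, ENNReal.ofReal δ ^ p +
        K * ((T R μ + R * (1 - ∑ i ∈ Finset.range N, (μ : Measure X) (A i))) +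
          (T R μ + R * (1 - ∑ i ∈ Finset.range N, (μ : Measure X) (A i)))) < ε := by
      have hs : Tendsto (fun N => ∑ i ∈ Finset.range N, (μ : Measure X) (A i)) atTop (𝓝 1) := by
        have : ∑' i, (μ : Measure X) (A i) = 1 := by
          rw [← measure_iUnion hAp hA, hAU, measure_univ]
        rw [← this]
        exact ENNReal.tendsto_nat_tsum _
      have h1 := ENNReal.Tendsto.sub (tendsto_const_nhds (x := (1 : ℝ≥0∞)) (f := atTop (α := ℕ))) hs
        (Or.inl ENNReal.one_ne_top)
      have h2 := (ENNReal.Tendsto.const_mul h1 (Or.inr (ENNReal.coe_ne_top (r := R)))).const_add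
        (T R μ)
      have h3 := (ENNReal.Tendsto.const_mul (h2.add h2) (Or.inr hK)).const_add
        (ENNReal.ofReal δ ^ p)
      simp only [tsub_self, mul_zero, add_zero] at h3
      exact (h3.eventually_lt_const hR).exists
    -- The cells are continuity sets of the limit, so their masses converge and the transported mass
    -- tends to the limit mass of the first `N` cells.
    have hsum : Tendsto (fun i => ∑ j ∈ Finset.range N,
        min ((μs i : Measure X) (A j)) ((μ : Measure X) (A j))) l
        (𝓝 (∑ j ∈ Finset.range N, (μ : Measure X) (A j))) := by
      refine tendsto_finsetSum _ fun j _ => ?_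
      have := (ProbabilityMeasure.tendsto_measure_of_null_frontier_of_tendsto' h (hA0 j)).min
        (tendsto_const_nhds (x := (μ : Measure X) (A j)))
      rwa [min_self] at this
    have hbound : Tendsto (fun i => ENNReal.ofReal δ ^ p +
        K * ((T R (μs i) + R * (1 - ∑ j ∈ Finset.range N,
            min ((μs i : Measure X) (A j)) ((μ : Measure X) (A j)))) +
          (T R μ + R * (1 - ∑ j ∈ Finset.range N,
            min ((μs i : Measure X) (A j)) ((μ : Measure X) (A j)))))) l
        (𝓝 (ENNReal.ofReal δ ^ p +
        K * ((T R μ + R * (1 - ∑ i ∈ Finset.range N, (μ : Measure X) (A i))) +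
          (T R μ + R * (1 - ∑ i ∈ Finset.range N, (μ : Measure X) (A i)))))) := by
      have h1 := ENNReal.Tendsto.const_mul (ENNReal.Tendsto.sub
        (tendsto_const_nhds (x := (1 : ℝ≥0∞)) (f := l)) hsum (Or.inl ENNReal.one_ne_top))
        (Or.inr (ENNReal.coe_ne_top (r := R)))
      have hT : Tendsto (fun i => T R (μs i)) l (𝓝 (T R μ)) :=
        tendsto_lintegral_tail h hf hlim hfin R
      exact (ENNReal.Tendsto.const_mul ((hT.add h1).add (h1.const_add _)) (Or.inr hK)).const_add _
    filter_upwards [hbound.eventually_lt_const hN] with i hi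
    obtain ⟨η, e₁, e₂, e₃, e₄⟩ :=
      exists_partial_coupling hp0 (μs i : Measure X) (μ : Measure X) hA hAp hAd N
    refine le_trans ?_ hi.le
    refine (wasserstein_rpow_le_of_partial_coupling hp e₁ e₂ x₀ R).trans ?_
    simp_rw [hfe]
    rw [e₃]
    gcongr
  have := (ENNReal.continuous_rpow_const (y := p⁻¹)).tendsto 0 |>.comp hW
  simpa [Function.comp_def, ← ENNReal.rpow_mul, hp0.ne', hp0] using this

end WeakConvergence

/-! ### From averaged to pointwise convergence on the support. -/

section LocalConvergence

variable {X : Type*} [MetricSpace X] [MeasurableSpace X] [BorelSpace X] {lam : Measure X}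
  [IsFiniteMeasure lam]

theorem exists_bump_of_mem_support {x : X} (hx : x ∈ lam.support) {r : ℝ≥0} (hr : 0 < r) :
    ∃ φ : X → ℝ≥0, Continuous φ ∧ (∀ y, φ y ≤ 1) ∧ (∀ y, φ y ≠ 0 → nndist x y ≤ r) ∧
      ∫⁻ y, φ y ∂lam ≠ 0 ∧ ∫⁻ y, φ y ∂lam ≠ ∞ := by
  have hc : Continuous fun y => 1 - nndist x y / r := by fun_prop
  refine ⟨fun y => 1 - nndist x y / r, hc, fun y => tsub_le_self, fun y hy => ?_, ?_, ?_⟩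
  · by_contra! h
    exact hy (tsub_eq_zero_of_le ((one_le_div hr).2 h.le))
  · rw [← pos_iff_ne_zero, lintegral_pos_iff_support (hc.measurable.coe_nnreal_ennreal)]
    refine ((Measure.mem_support_iff_forall x).1 hx _ (Metric.ball_mem_nhds x (ε := r) hr)).trans_le
      (measure_mono fun y hy => ?_)
    have : nndist x y < r := NNReal.coe_lt_coe.1 ((coe_nndist x y).trans_lt (Metric.mem_ball'.1 hy))
    simp only [Function.mem_support, ne_eq, ENNReal.coe_eq_zero, tsub_eq_zero_iff_le, not_le]
    exact (div_lt_one hr).2 this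
  · refine ((lintegral_mono (g := fun _ => 1) fun y => ?_).trans_lt ?_).ne
    · exact ENNReal.coe_le_one_iff.2 tsub_le_self
    · simp

/-- Uniformly Lipschitz functions that converge after integration against all bump functions
converge at every point of the support. -/
theorem tendsto_of_tendsto_lintegral_mul {ι : Type*} {l : Filter ι} {q : ℝ} (hq : 0 < q)
    {Fs : ι → X → ℝ≥0∞} {F : X → ℝ≥0∞} {K : ℝ≥0} (hFs : ∀ i x y, Fs i x ≤ Fs i y + K * edist x y)
    (hF : ∀ x y, F x ≤ F y + K * edist x y)
    (h : ∀ φ : X → ℝ≥0, Continuous φ → (∀ y, φ y ≤ 1) →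
      Tendsto (fun i => ∫⁻ y, φ y * Fs i y ^ q ∂lam) l (𝓝 (∫⁻ y, φ y * F y ^ q ∂lam)))
    {x : X} (hx : x ∈ lam.support) (hfin : F x ≠ ∞) :
    Tendsto (fun i => Fs i x) l (𝓝 (F x)) := by
  refine (ENNReal.tendsto_nhds hfin).2 fun ε hε => ?_
  obtain ⟨δ', hδ', hδε⟩ := ENNReal.lt_iff_exists_nnreal_btwn.1 hε
  obtain ⟨δ, hδ, hδ3⟩ : ∃ δ : ℝ≥0, 0 < δ ∧ (δ : ℝ≥0∞) + 2 * δ ≤ ε := by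
    refine ⟨δ' / 3, div_pos (by exact_mod_cast hδ') three_pos, le_trans ?_ hδε.le⟩
    rw [show ((δ' / 3 : ℝ≥0) : ℝ≥0∞) + 2 * ((δ' / 3 : ℝ≥0) : ℝ≥0∞)
      = ((δ' / 3 + 2 * (δ' / 3) : ℝ≥0) : ℝ≥0∞) by push_cast; rfl]
    refine ENNReal.coe_le_coe.2 (le_of_eq ?_)
    apply NNReal.eq
    push_cast
    ring
  -- On a ball of this radius, `F` and every `Fs i` vary by at most `δ`. Using `K + 1` also covers
  -- `K = 0`.
  obtain ⟨φ, hφc, hφ1, hφr, hZ0, hZ⟩ := exists_bump_of_mem_support hx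
    (r := δ / (K + 1)) (div_pos hδ (by positivity))
  set Z := ∫⁻ y, φ y ∂lam
  have hnear : ∀ y, φ y ≠ 0 → K * edist x y ≤ (δ : ℝ≥0∞) := fun y hy => by
    rw [edist_nndist, ← ENNReal.coe_mul]
    refine ENNReal.coe_le_coe.2 ((mul_le_mul_right (hφr y hy) K).trans ?_)
    rw [mul_div_assoc', div_le_iff₀ (by positivity), mul_comm]
    gcongr
    exact le_self_add
  have hlow : ∀ (G : X → ℝ≥0∞) (a : ℝ≥0∞), (∀ y, φ y ≠ 0 → a ≤ G y) →
      Z * a ^ q ≤ ∫⁻ y, φ y * G y ^ q ∂lam := fun G a ha => by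
    rw [← lintegral_mul_const _ hφc.measurable.coe_nnreal_ennreal]
    refine lintegral_mono fun y => ?_
    by_cases hy : φ y = 0
    · simp [hy]
    · exact mul_le_mul_right (ENNReal.rpow_le_rpow (ha y hy) hq.le) _
  have hupp : ∀ (G : X → ℝ≥0∞) (a : ℝ≥0∞), (∀ y, φ y ≠ 0 → G y ≤ a) →
      ∫⁻ y, φ y * G y ^ q ∂lam ≤ Z * a ^ q := fun G a ha => by
    rw [← lintegral_mul_const _ hφc.measurable.coe_nnreal_ennreal]
    refine lintegral_mono fun y => ?_
    by_cases hy : φ y = 0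
    · simp [hy]
    · exact mul_le_mul_right (ENNReal.rpow_le_rpow (ha y hy) hq.le) _
  -- Levels `δ` apart give strictly separated integrals, which is the gap that convergence of the
  -- averages cannot cross.
  have hstrict : ∀ a : ℝ≥0∞, a ≠ ∞ → Z * a ^ q < Z * (a + δ) ^ q := fun a ha =>
    ENNReal.mul_lt_mul_right hZ0 hZ (ENNReal.rpow_lt_rpow
      (ENNReal.lt_add_right ha (by exact_mod_cast hδ.ne')) hq)
  -- A failure at `x` would force `Fs i ≥ F x + 2δ` wherever the bump is nonzero, while `F ≤ F x +
  -- δ` there.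
  have hup : ∀ᶠ i in l, Fs i x ≤ F x + ε := by
    have h1 : ∫⁻ y, φ y * F y ^ q ∂lam < Z * (F x + δ + δ) ^ q := by
      refine (hupp F (F x + δ) fun y hy => ?_).trans_lt
        (hstrict _ (ENNReal.add_ne_top.2 ⟨hfin, ENNReal.coe_ne_top⟩))
      refine (hF y x).trans ?_
      rw [edist_comm]
      gcongr
      exact hnear y hy
    filter_upwards [(h φ hφc hφ1).eventually_lt_const h1] with i hi
    by_contra! hcon
    refine hi.not_ge (hlow _ _ fun y hy => ?_)
    have h2 : F x + δ + δ + δ ≤ Fs i y + δ := by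
      calc F x + δ + δ + δ = F x + (δ + 2 * δ) := by ring
        _ ≤ F x + ε := by gcongr
        _ ≤ Fs i x := hcon.le
        _ ≤ Fs i y + K * edist x y := hFs i x y
        _ ≤ _ := by gcongr; exact hnear y hy
    exact (ENNReal.add_le_add_iff_right ENNReal.coe_ne_top).1 h2
  have hdown : ∀ᶠ i in l, F x ≤ Fs i x + ε := by
    -- Below `2δ` the lower bound is trivial. Otherwise put `b = F x - 2δ`: where the bump is
    -- nonzero `F ≥ b + δ`, and a failure at `x` would force `Fs i ≤ b` there.
    rcases le_total (F x) (2 * δ) with hle | hle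
    · exact Eventually.of_forall fun i =>
        hle.trans ((le_add_self.trans hδ3).trans le_add_self)
    obtain ⟨b, hb⟩ := exists_add_of_le hle
    have hbt : b ≠ ∞ := fun hb' => hfin (by rw [hb, hb', add_top])
    have h1 : Z * b ^ q < ∫⁻ y, φ y * F y ^ q ∂lam := by
      refine (hstrict b hbt).trans_le (hlow _ _ fun y hy => ?_)
      have h2 : b + δ + δ ≤ F y + δ := by
        calc b + δ + δ = F x := by rw [hb]; ring
          _ ≤ F y + K * edist x y := hF x y
          _ ≤ _ := by gcongr; exact hnear y hy
      exact (ENNReal.add_le_add_iff_right ENNReal.coe_ne_top).1 h2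
    filter_upwards [(h φ hφc hφ1).eventually_const_lt h1] with i hi
    by_contra! hcon
    refine hi.not_ge (hupp _ _ fun y hy => ?_)
    have h2 : Fs i x + δ ≤ b := by
      have h3 : Fs i x + δ + 2 * δ ≤ b + 2 * δ := by
        calc Fs i x + δ + 2 * δ = Fs i x + (δ + 2 * δ) := by ring
          _ ≤ Fs i x + ε := by gcongr
          _ ≤ F x := hcon.le
          _ = b + 2 * δ := by rw [hb, add_comm]
      exact (ENNReal.add_le_add_iff_right (by finiteness)).1 h3
    refine ((hFs i y x).trans ?_).trans h2
    rw [edist_comm]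
    gcongr
    exact hnear y hy
  filter_upwards [hup, hdown] with i h₁ h₂
  exact ⟨tsub_le_iff_right.2 h₂, h₁⟩

end LocalConvergence

theorem two_rpow_ne_top {p : ℝ} (hp : 1 ≤ p) : (2 : ℝ≥0∞) ^ (p - 1) ≠ ∞ :=
  ENNReal.rpow_ne_top_of_nonneg (by linarith) (by simp)

theorem edist_rpow_ne_top {X : Type*} [MetricSpace X] {p : ℝ} (hp : 1 ≤ p) (x y : X) :
    edist x y ^ p ≠ ∞ :=
  ENNReal.rpow_ne_top_of_nonneg (by linarith) (edist_ne_top _ _)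

/-! ### Finiteness of moments and change of base point. -/

section Moments

variable {X Y : Type*} [MetricSpace X] [MeasurableSpace X] [BorelSpace X]
  [MetricSpace Y] [MeasurableSpace Y] [BorelSpace Y] {p : ℝ}

theorem lintegral_edist_rpow_le (hp : 1 ≤ p) (μ : Measure X) [IsProbabilityMeasure μ]
    (x₀ x₁ : X) : ∫⁻ x, edist x₁ x ^ p ∂μ ≤
      2 ^ (p - 1) * (edist x₁ x₀ ^ p + ∫⁻ x, edist x₀ x ^ p ∂μ) := by
  calc ∫⁻ x, edist x₁ x ^ p ∂μ
      ≤ ∫⁻ x, 2 ^ (p - 1) * (edist x₁ x₀ ^ p + edist x₀ x ^ p) ∂μ := by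
        refine lintegral_mono fun x => ?_
        refine le_trans ?_ (ENNReal.rpow_add_le_mul_rpow_add_rpow _ _ hp)
        gcongr
        exact edist_triangle _ _ _
    _ = _ := by
        rw [lintegral_const_mul _ (by fun_prop), lintegral_add_left measurable_const,
          lintegral_const, measure_univ, mul_one]

theorem moment_ne_top (hp : 1 ≤ p) {lam : ProbabilityMeasure X} (h : lam ∈ measureSpace X p)
    (x₁ : X) : ∫⁻ x, edist x₁ x ^ p ∂(lam : Measure X) ≠ ∞ := by
  obtain ⟨x₀, hx₀⟩ := h
  exact ((lintegral_edist_rpow_le hp _ x₀ x₁).trans_lt (ENNReal.mul_lt_top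
    (two_rpow_ne_top hp).lt_top (ENNReal.add_lt_top.2 ⟨(edist_rpow_ne_top hp _ _).lt_top, hx₀⟩))).ne

theorem exists_kernel_moment_le {X Y : Type*} [MetricSpace X] [MeasurableSpace X]
    [MetricSpace Y] [MeasurableSpace Y] [BorelSpace Y] {p : ℝ} (hp : 1 ≤ p) {Q : Kernel X Y}
    (hQ : Q ∈ kernelSpace X Y p) (y₁ : Y) : ∃ x₀ : X, ∃ A B : ℝ≥0∞, A ≠ ∞ ∧ B ≠ ∞ ∧
      ∀ x, ∫⁻ y, edist y₁ y ^ p ∂(Q x) ≤ A + B * edist x₀ x ^ p := by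
  obtain ⟨hM, x₀, y₀, C, hC⟩ := hQ
  refine ⟨x₀, 2 ^ (p - 1) * edist y₁ y₀ ^ p + 2 ^ (p - 1) * C, 2 ^ (p - 1) * C,
    ENNReal.add_ne_top.2 ⟨ENNReal.mul_ne_top (two_rpow_ne_top hp) (edist_rpow_ne_top hp _ _),
      ENNReal.mul_ne_top (two_rpow_ne_top hp) ENNReal.coe_ne_top⟩,
    ENNReal.mul_ne_top (two_rpow_ne_top hp) ENNReal.coe_ne_top, fun x => ?_⟩
  refine (lintegral_edist_rpow_le hp _ y₀ y₁).trans ?_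
  have := hC x
  simp_rw [edist_comm _ y₀, edist_comm _ x₀] at this
  refine (mul_le_mul_right (add_le_add_right this _) _).trans (le_of_eq (by ring))

theorem kernel_moment_ne_top (hp : 1 ≤ p) {Q : Kernel X Y} (hQ : Q ∈ kernelSpace X Y p)
    (y₁ : Y) (x : X) : ∫⁻ y, edist y₁ y ^ p ∂(Q x) ≠ ∞ := by
  obtain ⟨x₀, A, B, hA, hB, h⟩ := exists_kernel_moment_le hp hQ y₁
  exact ((h x).trans_lt (ENNReal.add_lt_top.2 ⟨hA.lt_top,
    ENNReal.mul_lt_top hB.lt_top (edist_rpow_ne_top hp _ _).lt_top⟩)).ne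

theorem lintegral_kernel_moment_ne_top (hp : 1 ≤ p) {lam : ProbabilityMeasure X}
    (hlam : lam ∈ measureSpace X p) {Q : Kernel X Y} (hQ : Q ∈ kernelSpace X Y p)
    (y₁ : Y) : ∫⁻ x, ∫⁻ y, edist y₁ y ^ p ∂(Q x) ∂(lam : Measure X) ≠ ∞ := by
  obtain ⟨x₀, A, B, hA, hB, h⟩ := exists_kernel_moment_le hp hQ y₁
  refine ((lintegral_mono h).trans_lt ?_).ne
  rw [lintegral_add_left measurable_const, lintegral_const_mul _ (by fun_prop), lintegral_const,
    measure_univ, mul_one]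
  exact ENNReal.add_lt_top.2 ⟨hA.lt_top, ENNReal.mul_lt_top hB.lt_top
    (moment_ne_top hp hlam x₀).lt_top⟩

end Moments

/-! ### Pointwise Wasserstein convergence of kernels on the support. -/

section KernelConvergence

variable {X Y : Type*} [MetricSpace X] [MeasurableSpace X] [BorelSpace X]
  [MetricSpace Y] [MeasurableSpace Y] [BorelSpace Y] {p : ℝ}
  {lam : ProbabilityMeasure X}

theorem lintegral_mul_kernel_ne_top (hp : 1 ≤ p) (hlam : lam ∈ measureSpace X p) {Q : Kernel X Y}
    (hQ : Q ∈ kernelSpace X Y p) {y₀ : Y} {φ : X → ℝ≥0} (hφ1 : ∀ x, φ x ≤ 1)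
    {g : Y → ℝ≥0} (hgb : ∀ y, g y ≤ 1 + nndist y₀ y ^ p) :
    ∫⁻ x, φ x * ∫⁻ y, g y ∂(Q x) ∂(lam : Measure X) ≠ ∞ := by
  have := hQ.1
  have hle : ∀ x, (φ x : ℝ≥0∞) * ∫⁻ y, g y ∂(Q x) ≤ 1 + ∫⁻ y, edist y₀ y ^ p ∂(Q x) := fun x => by
    calc (φ x : ℝ≥0∞) * ∫⁻ y, g y ∂(Q x) ≤ 1 * ∫⁻ y, (1 + edist y₀ y ^ p) ∂(Q x) := by
          gcongr with y
          · exact_mod_cast hφ1 x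
          · rw [edist_nndist, ← ENNReal.coe_rpow_of_nonneg _ (by linarith)]
            exact_mod_cast hgb y
      _ = _ := by rw [one_mul, lintegral_add_left measurable_const, lintegral_const, measure_univ,
                    mul_one]
  refine ((lintegral_mono hle).trans_lt ?_).ne
  rw [lintegral_add_left measurable_const, lintegral_const, measure_univ, mul_one]
  exact ENNReal.add_lt_top.2 ⟨ENNReal.one_lt_top,
    (lintegral_kernel_moment_ne_top hp hlam hQ y₀).lt_top⟩

theorem kernel_lintegral_ne_top (hp : 1 ≤ p) {Q : Kernel X Y}
    (hQ : Q ∈ kernelSpace X Y p) {y₀ : Y} {g : Y → ℝ≥0} (hgb : ∀ y, g y ≤ 1 + nndist y₀ y ^ p)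
    (x : X) : ∫⁻ y, g y ∂(Q x) ≠ ∞ := by
  have := hQ.1
  have hle : ∫⁻ y, g y ∂(Q x) ≤ ∫⁻ y, (1 + edist y₀ y ^ p) ∂(Q x) := by
    gcongr with y
    rw [edist_nndist, ← ENNReal.coe_rpow_of_nonneg _ (by linarith)]
    exact_mod_cast hgb y
  refine (hle.trans_lt ?_).ne
  rw [lintegral_add_left measurable_const, lintegral_const, measure_univ, mul_one]
  exact ENNReal.add_lt_top.2 ⟨ENNReal.one_lt_top, (kernel_moment_ne_top hp hQ y₀ x).lt_top⟩

theorem integral_mul_kernel_eq (hp : 1 ≤ p) {Q : Kernel X Y}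
    (hQ : Q ∈ kernelSpace X Y p) {y₀ : Y} {φ : X → ℝ≥0} (hφ : Continuous φ)
    {g : Y → ℝ≥0} (hg : Continuous g) (hgb : ∀ y, g y ≤ 1 + nndist y₀ y ^ p) :
    ∫ x, ∫ y, ((φ x * g y : ℝ≥0) : ℝ) ∂(Q x) ∂(lam : Measure X) =
      (∫⁻ x, φ x * ∫⁻ y, g y ∂(Q x) ∂(lam : Measure X)).toReal := by
  have hinner : ∀ x, ∫ y, ((φ x * g y : ℝ≥0) : ℝ) ∂(Q x) =
      (φ x * ∫⁻ y, g y ∂(Q x)).toReal := fun x => by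
    rw [← lintegral_const_mul _ hg.measurable.coe_nnreal_ennreal]
    simp_rw [← ENNReal.coe_mul]
    rw [← integral_toReal (hg.measurable.const_mul (φ x)).coe_nnreal_ennreal.aemeasurable
      (ae_of_all _ fun _ => ENNReal.coe_lt_top)]
    simp
  simp_rw [hinner]
  refine integral_toReal (Measurable.aemeasurable ?_) (ae_of_all _ fun x => ?_)
  · exact hφ.measurable.coe_nnreal_ennreal.mul
      (Measurable.lintegral_kernel hg.measurable.coe_nnreal_ennreal)
  · exact ENNReal.mul_lt_top ENNReal.coe_lt_top (kernel_lintegral_ne_top hp hQ hgb x).lt_top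

/-- Products `φ x * g y` are admissible test functions. Since all the integrals are finite,
convergence of real integrals carries over to `ℝ≥0∞`. -/
theorem tendsto_lintegral_mul_kernel (hp : 1 ≤ p) (hlam : lam ∈ measureSpace X p)
    {Qs : ℕ → Kernel X Y} {Q : Kernel X Y} (hQs : ∀ n, Qs n ∈ kernelSpace X Y p)
    (hQ : Q ∈ kernelSpace X Y p) {y₀ : Y}
    (h : ∀ f : X × Y → ℝ, Continuous f → (∀ x y, |f (x, y)| ≤ 1 + dist y₀ y ^ p) →
      Tendsto (fun n => ∫ x, ∫ y, f (x, y) ∂(Qs n x) ∂(lam : Measure X)) atTop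
        (𝓝 (∫ x, ∫ y, f (x, y) ∂(Q x) ∂(lam : Measure X))))
    {φ : X → ℝ≥0} (hφ : Continuous φ) (hφ1 : ∀ x, φ x ≤ 1)
    {g : Y → ℝ≥0} (hg : Continuous g) (hgb : ∀ y, g y ≤ 1 + nndist y₀ y ^ p) :
    Tendsto (fun n => ∫⁻ x, φ x * ∫⁻ y, g y ∂(Qs n x) ∂(lam : Measure X)) atTop
      (𝓝 (∫⁻ x, φ x * ∫⁻ y, g y ∂(Q x) ∂(lam : Measure X))) := by
  have := h (fun z => ((φ z.1 * g z.2 : ℝ≥0) : ℝ)) (by fun_prop) fun x y => by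
    rw [NNReal.abs_eq]
    have h1 : φ x * g y ≤ 1 + nndist y₀ y ^ p :=
      (mul_le_of_le_one_left' (hφ1 x)).trans (hgb y)
    exact_mod_cast h1
  dsimp only at this
  rw [integral_mul_kernel_eq hp hQ hφ hg hgb] at this
  simp_rw [fun n => integral_mul_kernel_eq (lam := lam) hp (hQs n) hφ hg hgb] at this
  exact (ENNReal.tendsto_toReal_iff
    (fun n => lintegral_mul_kernel_ne_top hp hlam (hQs n) hφ1 hgb)
    (lintegral_mul_kernel_ne_top hp hlam hQ hφ1 hgb)).1 this

variable [SecondCountableTopology Y]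

/-- The `q`-th roots of these integrals are `C * L`-Lipschitz in `x`, uniformly in `n`, and their
`q`-th powers converge against every bump function, so `tendsto_of_tendsto_lintegral_mul` applies.
-/
theorem tendsto_lintegral_rpow_kernel (hp : 1 ≤ p) (hlam : lam ∈ measureSpace X p)
    {Qs : ℕ → Kernel X Y} {Q : Kernel X Y} (hQs : ∀ n, Qs n ∈ kernelSpace X Y p)
    (hQ : Q ∈ kernelSpace X Y p) {L : ℝ≥0} (hQsL : ∀ n, LipschitzKernelWith p L (Qs n))
    (hQL : LipschitzKernelWith p L Q) {y₀ : Y}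
    (h : ∀ f : X × Y → ℝ, Continuous f → (∀ x y, |f (x, y)| ≤ 1 + dist y₀ y ^ p) →
      Tendsto (fun n => ∫ x, ∫ y, f (x, y) ∂(Qs n x) ∂(lam : Measure X)) atTop
        (𝓝 (∫ x, ∫ y, f (x, y) ∂(Q x) ∂(lam : Measure X))))
    {q : ℝ} (hq : 1 ≤ q) (hqp : q ≤ p) {C : ℝ≥0} {u : Y → ℝ≥0} (hu : LipschitzWith C u)
    (hub : ∀ y, u y ^ q ≤ 1 + nndist y₀ y ^ p) {x : X} (hx : x ∈ (lam : Measure X).support) :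
    Tendsto (fun n => ∫⁻ y, (u y : ℝ≥0∞) ^ q ∂(Qs n x)) atTop
      (𝓝 (∫⁻ y, (u y : ℝ≥0∞) ^ q ∂(Q x))) := by
  have hq0 : 0 < q := by linarith
  have hue : ∀ y, (u y : ℝ≥0∞) ^ q = ((u y ^ q : ℝ≥0) : ℝ≥0∞) := fun y =>
    (ENNReal.coe_rpow_of_nonneg _ hq0.le).symm
  have huc : Continuous fun y => u y ^ q := (NNReal.continuous_rpow_const hq0.le).comp hu.continuous
  have hulip : ∀ y y', (u y : ℝ≥0∞) ≤ u y' + (C : ℝ≥0∞) * edist y y' := fun y y' => by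
    have h1 := hu y y'
    have h2 : (u y : ℝ≥0∞) - u y' ≤ edist (u y) (u y') := by
      rw [← ENNReal.coe_sub, edist_nndist, NNReal.nndist_eq]
      exact ENNReal.coe_le_coe.2 (le_max_left _ _)
    rw [add_comm]
    exact tsub_le_iff_right.1 (h2.trans h1)
  have hlip : ∀ R : Kernel X Y, R ∈ kernelSpace X Y p → LipschitzKernelWith p L R → ∀ x x',
      (∫⁻ y, (u y : ℝ≥0∞) ^ q ∂(R x)) ^ (1 / q) ≤
        (∫⁻ y, (u y : ℝ≥0∞) ^ q ∂(R x')) ^ (1 / q) + ((C * L : ℝ≥0) : ℝ≥0∞) * edist x x' := by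
    intro R hR hRL x x'
    have := hR.1
    refine (lintegral_rpow_le_add_wasserstein (ν := R x') hq hqp
      hu.continuous.measurable.coe_nnreal_ennreal
      ENNReal.coe_ne_top hulip).trans ?_
    rw [ENNReal.coe_mul, mul_assoc]
    gcongr
    exact hRL x x'
  have hinv : ∀ a : ℝ≥0∞, (a ^ (1 / q)) ^ q = a := fun a => by
    rw [← ENNReal.rpow_mul, one_div_mul_cancel hq0.ne', ENNReal.rpow_one]
  have key := tendsto_of_tendsto_lintegral_mul (lam := (lam : Measure X)) hq0
    (fun n => hlip (Qs n) (hQs n) (hQsL n)) (hlip Q hQ hQL) (l := atTop) (fun φ hφ hφ1 => by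
      simp_rw [hinv, hue]
      exact tendsto_lintegral_mul_kernel hp hlam hQs hQ h hφ hφ1 huc hub) hx (by
      refine ENNReal.rpow_ne_top_of_nonneg (by positivity) ?_
      simp_rw [hue]
      exact kernel_lintegral_ne_top hp hQ hub x)
  have := ((ENNReal.continuous_rpow_const (y := q)).tendsto _).comp key
  simpa only [Function.comp_def, hinv] using this

/-- Weak convergence of a Lipschitz sequence of kernels implies Wasserstein convergence at every
point of the support of the marginal. -/
theorem tendsto_wasserstein_of_mem_support (hp : 1 ≤ p) (hlam : lam ∈ measureSpace X p)
    {Qs : ℕ → Kernel X Y} {Q : Kernel X Y} (hQs : ∀ n, Qs n ∈ kernelSpace X Y p)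
    (hQ : Q ∈ kernelSpace X Y p) {L : ℝ≥0} (hQsL : ∀ n, LipschitzKernelWith p L (Qs n))
    (hQL : LipschitzKernelWith p L Q) (hconv : WeakConvKernel p lam Qs Q)
    {x : X} (hx : x ∈ (lam : Measure X).support) :
    Tendsto (fun n => wasserstein p (Qs n x) (Q x)) atTop (𝓝 0) := by
  obtain ⟨y₀, h⟩ := hconv
  have hM := hQ.1
  have hMs := fun n => (hQs n).1
  have hmom := tendsto_lintegral_rpow_kernel hp hlam hQs hQ hQsL hQL h hp le_rfl
    (u := fun y => nndist y₀ y) (C := 1) (LipschitzWith.dist_right y₀) (fun y => le_add_self) hx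
  simp_rw [← edist_nndist] at hmom
  refine tendsto_wasserstein_of_tendsto
    (μs := fun n => (⟨Qs n x, inferInstance⟩ : ProbabilityMeasure Y))
    (μ := (⟨Q x, inferInstance⟩ : ProbabilityMeasure Y)) hp ?_ y₀ hmom
    (kernel_moment_ne_top hp hQ y₀ x)
  refine tendsto_iff_forall_lipschitz_integral_tendsto.2 ?_
  rintro f ⟨B, hB⟩ ⟨K, hK⟩
  have hB0 : 0 ≤ B := dist_nonneg.trans (hB y₀ y₀)
  -- Here `B` bounds the oscillation of `f`, so `f - f y₀ + B` lies in `[0, 2B]` and division by `c`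
  -- brings it into `[0, 1]`. The extra `1` keeps `c` positive when `B = 0`.
  set c : ℝ := 2 * B + 1
  have hc : 0 < c := by positivity
  set u : Y → ℝ≥0 := fun y => Real.toNNReal ((f y - f y₀ + B) / c)
  have hu0 : ∀ y, 0 ≤ (f y - f y₀ + B) / c := fun y => by
    have := (abs_le.1 ((Real.dist_eq _ _).symm.trans_le (hB y y₀))).1
    exact div_nonneg (by linarith) hc.le
  have hu1 : ∀ y, u y ≤ 1 := fun y => by
    have := (abs_le.1 ((Real.dist_eq _ _).symm.trans_le (hB y y₀))).2
    rw [Real.toNNReal_le_one, div_le_one hc]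
    linarith
  have hul : LipschitzWith (K * Real.toNNReal c⁻¹) u := by
    refine LipschitzWith.of_dist_le_mul fun y y' => ?_
    rw [NNReal.dist_eq, Real.coe_toNNReal _ (hu0 y), Real.coe_toNNReal _ (hu0 y'), ← sub_div,
      abs_div, abs_of_pos hc]
    have := hK.dist_le_mul y y'
    rw [Real.dist_eq] at this
    rw [NNReal.coe_mul, Real.coe_toNNReal _ (by positivity), div_eq_mul_inv, mul_right_comm]
    gcongr
    rwa [show f y - f y₀ + B - (f y' - f y₀ + B) = f y - f y' by ring]
  have hlim := tendsto_lintegral_rpow_kernel hp hlam hQs hQ hQsL hQL h le_rfl hp hul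
    (fun y => by
      rw [NNReal.rpow_one]
      exact (hu1 y).trans le_self_add) hx
  simp_rw [ENNReal.rpow_one] at hlim
  have hint : ∀ μ : Measure Y, IsProbabilityMeasure μ →
      ∫ y, f y ∂μ = c * (∫⁻ y, u y ∂μ).toReal + (f y₀ - B) := fun μ _ => by
    have hui : Integrable (fun y => (u y : ℝ)) μ :=
      Integrable.of_bound (C := 1) (hul.continuous.measurable.coe_nnreal_real.aestronglyMeasurable)
        (ae_of_all _ fun y => by
          rw [Real.norm_eq_abs, NNReal.abs_eq]
          exact_mod_cast hu1 y)
    have hfu : ∀ y, f y = c * (u y : ℝ) + (f y₀ - B) := fun y => by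
      rw [Real.coe_toNNReal _ (hu0 y)]
      field_simp
      ring
    calc ∫ y, f y ∂μ = ∫ y, (c * (u y : ℝ) + (f y₀ - B)) ∂μ := integral_congr_ae (ae_of_all _ hfu)
      _ = _ := by
        rw [integral_add (hui.const_mul c) (integrable_const _), integral_const_mul, integral_const]
        rw [← integral_toReal hul.continuous.measurable.coe_nnreal_ennreal.aemeasurable
          (ae_of_all _ fun _ => ENNReal.coe_lt_top)]
        simp
  have hfin : ∀ μ : Measure Y, IsProbabilityMeasure μ → ∫⁻ y, u y ∂μ ≠ ∞ := fun μ _ => by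
    refine ((lintegral_mono (g := fun _ => 1) fun y => ?_).trans_lt ?_).ne
    · exact ENNReal.coe_le_one_iff.2 (hu1 y)
    · simp
  simp only [ProbabilityMeasure.coe_mk]
  rw [hint _ (hM.isProbabilityMeasure x)]
  simp_rw [fun n => hint _ ((hMs n).isProbabilityMeasure x)]
  exact (((ENNReal.tendsto_toReal (hfin _ (hM.isProbabilityMeasure x))).comp hlim).const_mul
    c).add_const _

end KernelConvergence

theorem lintegral_const_add_edist_rpow_ne_top {X : Type*} [MetricSpace X] [MeasurableSpace X]
    [BorelSpace X] {p : ℝ} (hp : 1 ≤ p) {lam : ProbabilityMeasure X}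
    (hlam : lam ∈ measureSpace X p) {c K : ℝ≥0∞} (hc : c ≠ ∞) (hK : K ≠ ∞) (x₀ : X) :
    ∫⁻ x, (c + K * edist x₀ x) ^ p ∂(lam : Measure X) ≠ ∞ := by
  have hp0 : 0 ≤ p := by linarith
  have hle : ∀ x, (c + K * edist x₀ x) ^ p ≤ 2 ^ (p - 1) * (c ^ p + K ^ p * edist x₀ x ^ p) :=
    fun x => by
      rw [← ENNReal.mul_rpow_of_nonneg _ _ hp0]
      exact ENNReal.rpow_add_le_mul_rpow_add_rpow _ _ hp
  refine ((lintegral_mono hle).trans_lt ?_).ne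
  rw [lintegral_const_mul _ (by fun_prop), lintegral_add_left measurable_const,
    lintegral_const_mul _ (by fun_prop), lintegral_const, measure_univ, mul_one]
  exact ENNReal.mul_lt_top (two_rpow_ne_top hp).lt_top (ENNReal.add_lt_top.2
    ⟨ENNReal.rpow_lt_top_of_nonneg hp0 hc, ENNReal.mul_lt_top
      (ENNReal.rpow_lt_top_of_nonneg hp0 hK) (moment_ne_top hp hlam x₀).lt_top⟩)

/-! ### The integrated transportation distance. -/

section IntegratedDistance

variable {X Y : Type*}
  [MetricSpace X] [MeasurableSpace X] [MetricSpace Y] [MeasurableSpace Y]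
  {p : ℝ} {P Q R : Kernel X Y} {L : ℝ≥0}

theorem LipschitzKernelWith.mono {L L' : ℝ≥0} (h : LipschitzKernelWith p L P) (hL : L ≤ L') :
    LipschitzKernelWith p L' P := fun x x' =>
  (h x x').trans (mul_le_mul_left (ENNReal.coe_le_coe.2 hL) _)

theorem itd_comm (hp : 1 ≤ p) (lam : ProbabilityMeasure X) (P Q : Kernel X Y) :
    itd p lam P Q = itd p lam Q P := by
  simp only [itd, wasserstein_comm (zero_lt_one.trans_le hp) (P _)]

variable [PolishSpace Y] [BorelSpace Y]

/-- Two triangle inequalities, one Lipschitz bound for each kernel. This yields the measurability of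
the integrand, the change of marginal and the dominating function below. -/
theorem wasserstein_kernel_le_add (hp : 1 ≤ p) [IsMarkovKernel P] [IsMarkovKernel Q]
    (hPL : LipschitzKernelWith p L P) (hQL : LipschitzKernelWith p L Q) (x x' : X) :
    wasserstein p (P x) (Q x) ≤
      wasserstein p (P x') (Q x') + ((2 * L : ℝ≥0) : ℝ≥0∞) * edist x x' := by
  calc wasserstein p (P x) (Q x)
      ≤ wasserstein p (P x) (P x') + (wasserstein p (P x') (Q x') + wasserstein p (Q x') (Q x)) :=
        (wasserstein_triangle hp _ (P x') _).trans
          (add_le_add_right (wasserstein_triangle hp _ (Q x') _) _)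
    _ ≤ L * edist x x' + (wasserstein p (P x') (Q x') + L * edist x x') := by
        gcongr
        · exact hPL x x'
        · exact (hQL x' x).trans_eq (by rw [edist_comm])
    _ = _ := by push_cast; ring

theorem continuous_wasserstein_kernel (hp : 1 ≤ p) [IsMarkovKernel P] [IsMarkovKernel Q]
    (hPL : LipschitzKernelWith p L P) (hQL : LipschitzKernelWith p L Q) :
    Continuous fun x => wasserstein p (P x) (Q x) :=
  continuous_of_le_add_edist _ ENNReal.coe_ne_top (wasserstein_kernel_le_add hp hPL hQL)

variable [BorelSpace X]

theorem wasserstein_kernel_ne_top (hp : 1 ≤ p) (hP : P ∈ kernelSpace X Y p)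
    (hQ : Q ∈ kernelSpace X Y p) (x : X) : wasserstein p (P x) (Q x) ≠ ∞ := by
  have := hP.1
  have := hQ.1
  obtain ⟨y₀⟩ : Nonempty Y := nonempty_of_isProbabilityMeasure (P x)
  have hc := prod_mem_couplings (P x) (Q x)
  refine ((wasserstein_le (by linarith) hc).trans_lt
    (ENNReal.rpow_lt_top_of_nonneg (by positivity) ?_)).ne
  exact ((lintegral_coupling_le hp hc y₀).trans_lt (ENNReal.mul_lt_top (two_rpow_ne_top hp).lt_top
    (ENNReal.add_lt_top.2 ⟨(kernel_moment_ne_top hp hP y₀ x).lt_top,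
      (kernel_moment_ne_top hp hQ y₀ x).lt_top⟩))).ne

/-- Pointwise triangle inequality, then Minkowski in `L^p`. The Lipschitz hypotheses supply the
measurability that Minkowski needs. -/
theorem itd_triangle (hp : 1 ≤ p) (lam : ProbabilityMeasure X) [IsMarkovKernel P]
    [IsMarkovKernel Q] [IsMarkovKernel R] (hPL : LipschitzKernelWith p L P)
    (hQL : LipschitzKernelWith p L Q) (hRL : LipschitzKernelWith p L R) :
    itd p lam P R ≤ itd p lam P Q + itd p lam Q R := by
  refine le_trans ?_ (ENNReal.lintegral_Lp_add_le
    (continuous_wasserstein_kernel hp hPL hQL).measurable.aemeasurable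
    (continuous_wasserstein_kernel hp hQL hRL).measurable.aemeasurable hp)
  unfold itd
  gcongr with x
  exact wasserstein_triangle hp _ _ _

variable [PolishSpace X]

theorem itd_le_add_wasserstein (hp : 1 ≤ p) (lam lam' : ProbabilityMeasure X) [IsMarkovKernel P]
    [IsMarkovKernel Q] (hPL : LipschitzKernelWith p L P) (hQL : LipschitzKernelWith p L Q) :
    itd p lam P Q ≤ itd p lam' P Q +
      ((2 * L : ℝ≥0) : ℝ≥0∞) * wasserstein p (lam : Measure X) lam' :=
  lintegral_rpow_le_add_wasserstein hp le_rfl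
    (continuous_wasserstein_kernel hp hPL hQL).measurable ENNReal.coe_ne_top
    (wasserstein_kernel_le_add hp hPL hQL)

theorem itd_ne_top (hp : 1 ≤ p) {lam : ProbabilityMeasure X} (hlam : lam ∈ measureSpace X p)
    (hP : P ∈ kernelSpace X Y p) (hQ : Q ∈ kernelSpace X Y p) (hPL : LipschitzKernelWith p L P)
    (hQL : LipschitzKernelWith p L Q) : itd p lam P Q ≠ ∞ := by
  have := hP.1
  have := hQ.1
  obtain ⟨x₀⟩ : Nonempty X := nonempty_of_isProbabilityMeasure (lam : Measure X)
  refine ENNReal.rpow_ne_top_of_nonneg (by positivity) ?_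
  refine ((lintegral_mono fun x => ?_).trans_lt (lintegral_const_add_edist_rpow_ne_top hp hlam
    (wasserstein_kernel_ne_top hp hP hQ x₀) ENNReal.coe_ne_top x₀
    (K := ((2 * L : ℝ≥0) : ℝ≥0∞))).lt_top).ne
  refine ENNReal.rpow_le_rpow ?_ (by linarith)
  rw [edist_comm]
  exact wasserstein_kernel_le_add hp hPL hQL x x₀

/-- Weak convergence of a Lipschitz sequence of kernels implies convergence in the integrated
transportation distance. -/
theorem tendsto_itd_zero (hp : 1 ≤ p) {lam : ProbabilityMeasure X} (hlam : lam ∈ measureSpace X p)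
    {Qs : ℕ → Kernel X Y} (hQs : ∀ n, Qs n ∈ kernelSpace X Y p) (hQ : Q ∈ kernelSpace X Y p)
    (hQsL : ∀ n, LipschitzKernelWith p L (Qs n)) (hQL : LipschitzKernelWith p L Q)
    (hconv : WeakConvKernel p lam Qs Q) :
    Tendsto (fun n => itd p lam (Qs n) Q) atTop (𝓝 0) := by
  have hp0 : 0 < p := by linarith
  have hM := hQ.1
  have hMs := fun n => (hQs n).1
  have hpt := fun x (hx : x ∈ (lam : Measure X).support) =>
    tendsto_wasserstein_of_mem_support hp hlam hQs hQ hQsL hQL hconv hx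
  obtain ⟨x₀, hx₀⟩ := Measure.nonempty_support (IsProbabilityMeasure.ne_zero (lam : Measure X))
  have hlim : Tendsto (fun n => ∫⁻ x, wasserstein p (Qs n x) (Q x) ^ p ∂(lam : Measure X)) atTop
      (𝓝 (∫⁻ _, 0 ∂(lam : Measure X))) := by
    -- At the support point `x₀` the distance is eventually at most `1`, and the Lipschitz bound
    -- spreads this to all `x`. Thus no uniform growth constant for the `Qs n` is required.
    refine tendsto_lintegral_filter_of_dominated_convergence
      (fun x => (1 + ((2 * L : ℝ≥0) : ℝ≥0∞) * edist x₀ x) ^ p)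
      (Eventually.of_forall fun n =>
        (continuous_wasserstein_kernel hp (hQsL n) hQL).measurable.pow_const p) ?_
      (lintegral_const_add_edist_rpow_ne_top hp hlam ENNReal.one_ne_top ENNReal.coe_ne_top x₀) ?_
    · filter_upwards [(hpt x₀ hx₀).eventually_le_const zero_lt_one] with n hn
      refine ae_of_all _ fun x => ENNReal.rpow_le_rpow ?_ hp0.le
      rw [edist_comm]
      exact (wasserstein_kernel_le_add hp (hQsL n) hQL x x₀).trans (add_le_add_left hn _)
    · filter_upwards [Measure.support_mem_ae (μ := (lam : Measure X))] with x hx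
      have := ((ENNReal.continuous_rpow_const (y := p)).tendsto 0).comp (hpt x hx)
      rwa [ENNReal.zero_rpow_of_pos hp0] at this
  rw [lintegral_zero] at hlim
  have := ((ENNReal.continuous_rpow_const (y := 1 / p)).tendsto 0).comp hlim
  rwa [ENNReal.zero_rpow_of_pos (by positivity)] at this

theorem tendsto_wasserstein_of_weakConvMeasure (hp : 1 ≤ p) {lams : ℕ → ProbabilityMeasure X}
    {lam : ProbabilityMeasure X} (hlam : lam ∈ measureSpace X p)
    (h : WeakConvMeasure p lams lam) :
    Tendsto (fun k => wasserstein p (lams k : Measure X) lam) atTop (𝓝 0) := by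
  obtain ⟨h₁, x₀, h₂⟩ := h
  exact tendsto_wasserstein_of_tendsto hp h₁ x₀ h₂ (moment_ne_top hp hlam x₀)

end IntegratedDistance

end ITD

/-! ### The joint limit. -/

theorem mainTheorem1 {X Y : Type*}
    [MetricSpace X] [PolishSpace X] [MeasurableSpace X] [BorelSpace X]
    [MetricSpace Y] [PolishSpace Y] [MeasurableSpace Y] [BorelSpace Y]
    (p : ℝ) (hp : 1 ≤ p)
    (lam : ProbabilityMeasure X) (hlam : lam ∈ ITD.measureSpace X p)
    (lams : ℕ → ProbabilityMeasure X) (hlams : ∀ k, lams k ∈ ITD.measureSpace X p)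
    (P Q : Kernel X Y) (hP : P ∈ ITD.kernelSpace X Y p) (hQ : Q ∈ ITD.kernelSpace X Y p)
    (Ps Qs : ℕ → Kernel X Y) (hPs : ∀ m, Ps m ∈ ITD.kernelSpace X Y p)
    (hQs : ∀ n, Qs n ∈ ITD.kernelSpace X Y p)
    (hPL : ∃ L : ℝ≥0, ITD.LipschitzKernelWith p L P)
    (hQL : ∃ L : ℝ≥0, ITD.LipschitzKernelWith p L Q)
    (hPsL : ∃ L : ℝ≥0, ∀ m, ITD.LipschitzKernelWith p L (Ps m))
    (hQsL : ∃ L : ℝ≥0, ∀ n, ITD.LipschitzKernelWith p L (Qs n))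
    (hlamconv : ITD.WeakConvMeasure p lams lam)
    (hPconv : ITD.WeakConvKernel p lam Ps P)
    (hQconv : ITD.WeakConvKernel p lam Qs Q) :
    (∀ k m n, ITD.itd p (lams k) (Ps m) (Qs n) ≠ ∞) ∧
    ITD.itd p lam P Q ≠ ∞ ∧
    Tendsto (fun t : ℕ × ℕ × ℕ => ITD.itd p (lams t.1) (Ps t.2.1) (Qs t.2.2)) atTop
      (𝓝 (ITD.itd p lam P Q)) := by
  obtain ⟨L, hPL, hQL, hPsL, hQsL⟩ : ∃ L : ℝ≥0, ITD.LipschitzKernelWith p L P ∧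
      ITD.LipschitzKernelWith p L Q ∧ (∀ m, ITD.LipschitzKernelWith p L (Ps m)) ∧
      ∀ n, ITD.LipschitzKernelWith p L (Qs n) := by
    obtain ⟨⟨L₁, h₁⟩, ⟨L₂, h₂⟩, ⟨L₃, h₃⟩, ⟨L₄, h₄⟩⟩ := hPL, hQL, hPsL, hQsL
    exact ⟨max (max L₁ L₂) (max L₃ L₄), h₁.mono (by simp), h₂.mono (by simp),
      fun m => (h₃ m).mono (by simp), fun n => (h₄ n).mono (by simp)⟩
  have := hP.1
  have := hQ.1
  have := fun m => (hPs m).1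
  have := fun n => (hQs n).1
  have hfin := ITD.itd_ne_top hp hlam hP hQ hPL hQL
  refine ⟨fun k m n => ITD.itd_ne_top hp (hlams k) (hPs m) (hQs n) (hPsL m) (hQsL n), hfin, ?_⟩
  -- This error bounds the deviation in both directions. The kernel terms use the fixed marginal
  -- `lam`, the only one for which weak convergence of kernels is assumed.
  set e : ℕ × ℕ × ℕ → ℝ≥0∞ := fun t => (ITD.itd p lam (Ps t.2.1) P + ITD.itd p lam (Qs t.2.2) Q) +
    ((2 * L : ℝ≥0) : ℝ≥0∞) * ITD.wasserstein p (lams t.1 : Measure X) lam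
  have he : Tendsto e atTop (𝓝 0) := by
    have t₁ : Tendsto (fun t : ℕ × ℕ × ℕ => t.1) atTop atTop := by
      rw [← prod_atTop_atTop_eq]; exact tendsto_fst
    have t₂ : Tendsto (fun t : ℕ × ℕ × ℕ => t.2.1) atTop atTop := by
      rw [← prod_atTop_atTop_eq, ← prod_atTop_atTop_eq]; exact tendsto_fst.comp tendsto_snd
    have t₃ : Tendsto (fun t : ℕ × ℕ × ℕ => t.2.2) atTop atTop := by
      rw [← prod_atTop_atTop_eq, ← prod_atTop_atTop_eq]; exact tendsto_snd.comp tendsto_snd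
    have := (((ITD.tendsto_itd_zero hp hlam hPs hP hPsL hPL hPconv).comp t₂).add
      ((ITD.tendsto_itd_zero hp hlam hQs hQ hQsL hQL hQconv).comp t₃)).add
      (ENNReal.Tendsto.const_mul
        ((ITD.tendsto_wasserstein_of_weakConvMeasure hp hlam hlamconv).comp t₁)
        (Or.inr (ENNReal.coe_ne_top (r := 2 * L))))
    simpa only [add_zero, mul_zero, Function.comp_def] using this
  refine (ENNReal.tendsto_nhds hfin).2 fun ε hε => ?_
  filter_upwards [he.eventually_le_const hε] with t ht
  refine ⟨tsub_le_iff_right.2 (le_trans ?_ (add_le_add_right ht _)),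
    le_trans ?_ (add_le_add_right ht _)⟩
  · calc ITD.itd p lam P Q
        ≤ ITD.itd p lam P (Ps t.2.1) +
            (ITD.itd p lam (Ps t.2.1) (Qs t.2.2) + ITD.itd p lam (Qs t.2.2) Q) :=
          (ITD.itd_triangle hp lam hPL (hPsL _) hQL).trans
            (add_le_add_right (ITD.itd_triangle hp lam (hPsL _) (hQsL _) hQL) _)
      _ ≤ ITD.itd p lam (Ps t.2.1) P +
            ((ITD.itd p (lams t.1) (Ps t.2.1) (Qs t.2.2) +
              ((2 * L : ℝ≥0) : ℝ≥0∞) * ITD.wasserstein p (lams t.1 : Measure X) lam) +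
              ITD.itd p lam (Qs t.2.2) Q) := by
          rw [ITD.itd_comm hp lam P, ITD.wasserstein_comm (by linarith) (lams t.1 : Measure X)]
          gcongr
          exact ITD.itd_le_add_wasserstein hp _ _ (hPsL _) (hQsL _)
      _ = _ := by simp only [e]; ring
  · calc ITD.itd p (lams t.1) (Ps t.2.1) (Qs t.2.2)
        ≤ ITD.itd p lam (Ps t.2.1) (Qs t.2.2) +
            ((2 * L : ℝ≥0) : ℝ≥0∞) * ITD.wasserstein p (lams t.1 : Measure X) lam :=
          ITD.itd_le_add_wasserstein hp _ _ (hPsL _) (hQsL _)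
      _ ≤ (ITD.itd p lam (Ps t.2.1) P + (ITD.itd p lam P Q + ITD.itd p lam (Qs t.2.2) Q)) +
            ((2 * L : ℝ≥0) : ℝ≥0∞) * ITD.wasserstein p (lams t.1 : Measure X) lam := by
          rw [ITD.itd_comm hp lam (Qs _) Q]
          gcongr
          exact (ITD.itd_triangle hp lam (hPsL _) hPL (hQsL _)).trans
            (add_le_add_right (ITD.itd_triangle hp lam hPL hQL (hQsL _)) _)
      _ = _ := by simp only [e]; ring
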